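/- For $\tau$ in the upper half-plane $\mathcal H$ put $\Lambda_\tau=\mathbb Z\tau+\mathbb Z\subset\mathbb C$, and let $D_\tau:\Lambda_\tau\times\Lambda_\tau\to\mathbb Z$ be the unique skew-symmetric bilinear form with $D_\tau(\tau,1)=1$. Let $\tau_B,\tau_E\in\mathcal H$, $c\in\Lambda_{\tau_E}\smallsetminus\{0\}$, $\delta\in\mathbb C$, put $\varepsilon=\delta-\frac12c\tau_B$, and let $\Pi$ be the group of affine transformations of $\mathbb C^2$ generated by $$\gamma_1(z,\zeta)=(z+\tau_B,\zeta+cz+\delta),\quad \gamma_2(z,\zeta)=(z+1,\zeta),\quad \gamma_3(z,\zeta)=(z,\zeta+\tau_E),\quad \gamma_4(z,\zeta)=(z,\zeta+1).$$ Let $X$ be a Kodaira surface corresponding to the data $(\tau_B,\tau_E,c,\delta)$, i.e. a complex manifold biholomorphic to $\mathbb C^2/\Pi$; fix such an isomorphism and let $q:\mathbb C^2\to X$ be the resulting universal covering. For $\alpha\in\mathbb C\smallsetminus\{0\}$ with $\alpha\Lambda_{\tau_B}\subseteq\Lambda_{\tau_B}$ and $|\alpha|^2\in\mathbb Z$, and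 for $\beta,\sigma_{1,0},v\in\mathbb C$, consider the map $\Phi:\mathbb C^2\to\mathbb C^2$, $$\Phi(z,\zeta)=\Bigl(\alpha z+\beta,\ |\alpha|^2\zeta+\tfrac12D_{\tau_B}(\alpha,1)\,c\,\alpha z^2+\bigl(\sigma_{1,0}+D_{\tau_B}(\alpha,1)\bigl(c\beta+\varepsilon-\tfrac12D_{\tau_B}(\alpha,\tau_B)c\bigr)\bigr)z+v\Bigr).\qquad(*)$$ (a) Every surjective holomorphic map $f:X\to X$ lifts to a holomorphic automorphism $\Phi$ of $\mathbb C^2$ of the form $(*)$, for some such $\alpha,\beta,\sigma_{1,0},v$; that is, $q\circ\Phi=f\circ q$. (b) Conversely, a map $\Phi$ of the form $(*)$ descends to a surjective holomorphic map $f:X\to X$ (i.e. $q\circ\Phi=f\circ q$ for some such $f$) if and only if both 1. $\sigma_{1,0}\in\Lambda_{\tau_E}$; 2. $\sigma_{1,0}\tau_B-\bar\alpha\bigl(c\beta+(1-\alpha)\varepsilon\bigr)+\frac12c\,D_{\tau_B}(\alpha,1)\bigl(D_{\tau_B}(\alpha\tau_B,1)|\tau_B|^2-D_{\tau_B}(\alpha,\tau_B)\tau_B\bigr)\in\Lambda_{\tau_E}$.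 -/

import Mathlib

open scoped Manifold ContDiff ComplexConjugate UpperHalfPlane Topology

/-- The lattice `Λ_τ = ℤ τ + ℤ` in `ℂ`. -/
def tauLattice (τ : ℂ) : AddSubgroup ℂ := AddSubgroup.closure {τ, 1}

theorem mem_tauLattice {τ x : ℂ} : x ∈ tauLattice τ ↔ ∃ m n : ℤ, x = m * τ + n := by
  unfold tauLattice
  rw [AddSubgroup.mem_closure_pair]
  simp only [zsmul_eq_mul, mul_one]
  exact ⟨fun ⟨m, n, h⟩ => ⟨m, n, h.symm⟩, fun ⟨m, n, h⟩ => ⟨m, n, h.symm⟩⟩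

/-- The form `D_τ(x, y) = Im (x ȳ) / Im τ`. For `Im τ > 0`, its restriction to `Λ_τ` is the unique
skew-symmetric bi-additive integer-valued form with `D_τ(τ, 1) = 1`: see
`tauForm_eq_of_form` (uniqueness) and `exists_form_eq_tauForm` (existence) below. -/
noncomputable def tauForm (τ x y : ℂ) : ℝ := (x * conj y).im / τ.im

theorem tauForm_coord {τ : ℂ} (hτ : 0 < τ.im) (m n m' n' : ℤ) :
    tauForm τ (m * τ + n) (m' * τ + n') = ((m * n' - n * m' : ℤ) : ℝ) := by
  unfold tauForm
  rw [div_eq_iff hτ.ne']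
  simp
  ring

theorem exists_form_eq_tauForm {τ : ℂ} (hτ : 0 < τ.im) :
    ∃ B : tauLattice τ →+ tauLattice τ →+ ℤ,
      (∀ x y, B x y = -B y x) ∧ (∀ x y, (B x y : ℝ) = tauForm τ x y) ∧ tauForm τ τ 1 = 1 := by
  have key : ∀ x y : tauLattice τ, ∃ k : ℤ, (k : ℝ) = tauForm τ x y := by
    rintro ⟨x, hx⟩ ⟨y, hy⟩
    obtain ⟨m, n, rfl⟩ := mem_tauLattice.1 hx
    obtain ⟨m', n', rfl⟩ := mem_tauLattice.1 hy
    exact ⟨_, (tauForm_coord hτ m n m' n').symm⟩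
  choose b hb using key
  have hsub : ∀ x y z : ℂ, tauForm τ x (y + z) = tauForm τ x y + tauForm τ x z := by
    intro x y z; unfold tauForm; simp; ring
  have hsub' : ∀ x y z : ℂ, tauForm τ (x + y) z = tauForm τ x z + tauForm τ y z := by
    intro x y z; unfold tauForm; simp; ring
  refine ⟨AddMonoidHom.mk' (fun x => AddMonoidHom.mk' (fun y => b x y) ?_) ?_, ?_, ?_, ?_⟩
  · intro y z
    have : ((b x (y + z) : ℤ) : ℝ) = ((b x y + b x z : ℤ) : ℝ) := by
      push_cast
      rw [hb, hb, hb]; exact hsub _ _ _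
    exact_mod_cast this
  · intro x y
    ext z
    have : ((b (x + y) z : ℤ) : ℝ) = ((b x z + b y z : ℤ) : ℝ) := by
      push_cast
      rw [hb, hb, hb]; exact hsub' _ _ _
    exact_mod_cast this
  · intro x y
    have : ((b x y : ℤ) : ℝ) = ((-b y x : ℤ) : ℝ) := by
      push_cast
      rw [hb, hb]; unfold tauForm; simp; ring
    exact_mod_cast this
  · intro x y; exact hb x y
  · unfold tauForm; simp [hτ.ne']

theorem tauForm_eq_of_form {τ : ℂ} (hτ : 0 < τ.im) (B : tauLattice τ →+ tauLattice τ →+ ℤ)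
    (hskew : ∀ x y, B x y = -B y x)
    (h1 : B ⟨τ, AddSubgroup.subset_closure (by simp)⟩
      ⟨1, AddSubgroup.subset_closure (by simp)⟩ = 1)
    (x y : tauLattice τ) : (B x y : ℝ) = tauForm τ x y := by
  set t : tauLattice τ := ⟨τ, AddSubgroup.subset_closure (by simp)⟩ with ht
  set o : tauLattice τ := ⟨1, AddSubgroup.subset_closure (by simp)⟩ with ho
  have htt : B t t = 0 := by have := hskew t t; omega
  have hoo : B o o = 0 := by have := hskew o o; omega
  have hot : B o t = -1 := by rw [hskew, h1]
  obtain ⟨m, n, hx⟩ := mem_tauLattice.1 x.2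
  obtain ⟨m', n', hy⟩ := mem_tauLattice.1 y.2
  have hx' : x = m • t + n • o := by
    apply Subtype.ext; simp [hx, ht, ho]
  have hy' : y = m' • t + n' • o := by
    apply Subtype.ext; simp [hy, ht, ho]
  rw [hx, hy, tauForm_coord hτ, hx', hy']
  simp [htt, hoo, hot, h1]
  ring

/-- The data `(τ_B, τ_E, c, δ)` with `τ_B, τ_E` in the upper half-plane, `c ∈ Λ_{τ_E} ∖ {0}` and
`δ ∈ ℂ`. -/
structure KodairaData where
  τB : ℍ
  τE : ℍ
  c : ℂ
  δ : ℂ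
  c_mem : c ∈ tauLattice τE
  c_ne_zero : c ≠ 0

namespace KodairaData

/-- `γ₁(z, ζ) = (z + τ_B, ζ + c z + δ)`. -/
def γ₁ (K : KodairaData) : Equiv.Perm (ℂ × ℂ) where
  toFun p := (p.1 + K.τB, p.2 + K.c * p.1 + K.δ)
  invFun p := (p.1 - K.τB, p.2 - K.c * (p.1 - K.τB) - K.δ)
  left_inv p := by ext <;> simp <;> ring
  right_inv p := by ext <;> simp <;> ring

/-- `γ₂(z, ζ) = (z + 1, ζ)`. -/
def γ₂ (_K : KodairaData) : Equiv.Perm (ℂ × ℂ) where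
  toFun p := (p.1 + 1, p.2)
  invFun p := (p.1 - 1, p.2)
  left_inv p := by ext <;> simp
  right_inv p := by ext <;> simp

/-- `γ₃(z, ζ) = (z, ζ + τ_E)`. -/
def γ₃ (K : KodairaData) : Equiv.Perm (ℂ × ℂ) where
  toFun p := (p.1, p.2 + K.τE)
  invFun p := (p.1, p.2 - K.τE)
  left_inv p := by ext <;> simp
  right_inv p := by ext <;> simp

/-- `γ₄(z, ζ) = (z, ζ + 1)`. -/
def γ₄ (_K : KodairaData) : Equiv.Perm (ℂ × ℂ) where
  toFun p := (p.1, p.2 + 1)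
  invFun p := (p.1, p.2 - 1)
  left_inv p := by ext <;> simp
  right_inv p := by ext <;> simp

/-- The group of affine transformations of `ℂ²` generated by `γ₁, γ₂, γ₃, γ₄`. -/
def deckGroup (K : KodairaData) : Subgroup (Equiv.Perm (ℂ × ℂ)) :=
  Subgroup.closure {K.γ₁, K.γ₂, K.γ₃, K.γ₄}

/-- Every element of the group has an explicit affine form. -/
theorem deckGroup_form (K : KodairaData) {g : Equiv.Perm (ℂ × ℂ)} (hg : g ∈ K.deckGroup) :
    ∃ m n : ℤ, ∃ y ∈ tauLattice K.τE, ∀ z ζ : ℂ, g (z, ζ) =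
      (z + (m * K.τB + n),
        ζ + m * K.c * z + (m * K.δ + m * (m - 1) / 2 * K.c * K.τB + y)) := by
  have hτ : (K.τE : ℂ) ∈ tauLattice K.τE := AddSubgroup.subset_closure (by simp)
  have h1 : (1 : ℂ) ∈ tauLattice K.τE := AddSubgroup.subset_closure (by simp)
  unfold deckGroup at hg
  induction hg using Subgroup.closure_induction with
  | mem g hg =>
    rcases hg with rfl | rfl | rfl | rfl
    · exact ⟨1, 0, 0, zero_mem _, fun z ζ => by simp [γ₁, add_assoc]⟩
    · exact ⟨0, 1, 0, zero_mem _, fun z ζ => by simp [γ₂]⟩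
    · exact ⟨0, 0, K.τE, hτ, fun z ζ => by simp [γ₃]⟩
    · exact ⟨0, 0, 1, h1, fun z ζ => by simp [γ₄]⟩
  | one => exact ⟨0, 0, 0, zero_mem _, fun z ζ => by simp⟩
  | mul g h _ _ ihg ihh =>
    obtain ⟨m', n', y', hy', hg⟩ := ihg
    obtain ⟨m, n, y, hy, hh⟩ := ihh
    refine ⟨m + m', n + n', y + y' + (m' * n) • K.c,
      add_mem (add_mem hy hy') (zsmul_mem K.c_mem _), fun z ζ => ?_⟩
    rw [Equiv.Perm.mul_apply, hh, hg]
    ext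
    · push_cast; ring
    · simp only [zsmul_eq_mul]; push_cast; ring
  | inv g _ ih =>
    obtain ⟨m, n, y, hy, hg⟩ := ih
    refine ⟨-m, -n, (m * n) • K.c - y, sub_mem (zsmul_mem K.c_mem _) hy, fun z ζ => ?_⟩
    rw [Equiv.Perm.inv_eq_iff_eq, hg]
    ext
    · push_cast; ring
    · simp only [zsmul_eq_mul]; push_cast; ring

theorem deckGroup_contDiff (K : KodairaData) {g : Equiv.Perm (ℂ × ℂ)} (hg : g ∈ K.deckGroup) :
    ContDiff ℂ ω g := by
  obtain ⟨m, n, y, -, h⟩ := K.deckGroup_form hg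
  have : (g : ℂ × ℂ → ℂ × ℂ) = fun p => (p.1 + ((m : ℂ) * K.τB + n),
      p.2 + m * K.c * p.1 + (m * K.δ + m * (m - 1) / 2 * K.c * K.τB + y)) := by
    funext p; exact h p.1 p.2
  rw [this]
  fun_prop

/-- A nontrivial element of `Λ_τ` has modulus at least `min 1 (Im τ)`. -/
theorem lattice_discrete {τ : ℂ} (hτ : 0 < τ.im) {m n : ℤ}
    (h : ‖(m : ℂ) * τ + n‖ < min 1 τ.im) : m = 0 ∧ n = 0 := by
  have him := (Complex.abs_im_le_norm _).trans_lt (h.trans_le (min_le_right _ _))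
  have hm : m = 0 := by
    simp only [Complex.add_im, Complex.mul_im, Complex.intCast_re, Complex.intCast_im, zero_mul,
      add_zero] at him
    rw [abs_mul, abs_of_pos hτ] at him
    have : |(m : ℝ)| < 1 := by
      by_contra hc
      push Not at hc
      nlinarith
    exact Int.abs_lt_one_iff.1 (by exact_mod_cast this)
  subst hm
  have hn := h.trans_le (min_le_left _ _)
  simp only [Int.cast_zero, zero_mul, zero_add, Complex.norm_intCast] at hn
  exact ⟨rfl, Int.abs_lt_one_iff.1 (by exact_mod_cast hn)⟩

/-- A radius below which no nontrivial element of the group moves any point. -/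
noncomputable def radius (K : KodairaData) : ℝ := min (min 1 K.τB.im) (min 1 K.τE.im)

theorem radius_pos (K : KodairaData) : 0 < K.radius := by
  unfold radius
  simp [K.τB.im_pos, K.τE.im_pos]

theorem eq_one_of_dist_lt (K : KodairaData) {g : Equiv.Perm (ℂ × ℂ)} (hg : g ∈ K.deckGroup)
    {p : ℂ × ℂ} (h : dist (g p) p < K.radius) : g = 1 := by
  obtain ⟨m, n, y, hy, hf⟩ := K.deckGroup_form hg
  obtain ⟨k, l, rfl⟩ := mem_tauLattice.1 hy
  obtain ⟨z, ζ⟩ := p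
  rw [hf, Prod.dist_eq, max_lt_iff] at h
  obtain ⟨h₁, h₂⟩ := h
  simp only [dist_eq_norm, add_sub_cancel_left] at h₁
  obtain ⟨rfl, rfl⟩ := lattice_discrete K.τB.im_pos (h₁.trans_le (min_le_left _ _))
  simp only [dist_eq_norm, Int.cast_zero, zero_mul, add_zero, zero_div, zero_add,
    add_sub_cancel_left] at h₂
  obtain ⟨rfl, rfl⟩ := lattice_discrete K.τE.im_pos (h₂.trans_le (min_le_right _ _))
  ext ⟨a, b⟩ <;> simp [hf]

instance (K : KodairaData) : ContinuousConstSMul K.deckGroup (ℂ × ℂ) where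
  continuous_const_smul g := (K.deckGroup_contDiff g.2).continuous

/-- The surface `X_{c,δ} = ℂ² / ⟨γ₁, γ₂, γ₃, γ₄⟩`. -/
def Surface (K : KodairaData) : Type := MulAction.orbitRel.Quotient K.deckGroup (ℂ × ℂ)

/-- The projection `ℂ² → X_{c,δ}`. -/
def proj (K : KodairaData) : ℂ × ℂ → K.Surface :=
  Quotient.mk (MulAction.orbitRel K.deckGroup (ℂ × ℂ))

/-- The quotient topology. -/
instance (K : KodairaData) : TopologicalSpace K.Surface :=
  inferInstanceAs (TopologicalSpace (Quotient (MulAction.orbitRel K.deckGroup (ℂ × ℂ))))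

theorem proj_eq_iff (K : KodairaData) {p q : ℂ × ℂ} :
    K.proj p = K.proj q ↔ ∃ g ∈ K.deckGroup, g q = p := by
  have h : K.proj p = K.proj q ↔ p ∈ MulAction.orbit K.deckGroup q :=
    Quotient.eq (r := MulAction.orbitRel K.deckGroup (ℂ × ℂ))
  rw [h, MulAction.mem_orbit_iff]
  exact ⟨fun ⟨g, h⟩ => ⟨g.1, g.2, h⟩, fun ⟨g, hg, h⟩ => ⟨⟨g, hg⟩, h⟩⟩

theorem proj_surjective (K : KodairaData) : Function.Surjective K.proj := Quotient.mk_surjective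

theorem continuous_proj (K : KodairaData) : Continuous K.proj := continuous_quotient_mk'

theorem isOpenMap_proj (K : KodairaData) : IsOpenMap K.proj :=
  isOpenMap_quotient_mk'_mul (Γ := K.deckGroup) (T := ℂ × ℂ)

theorem injOn_proj (K : KodairaData) (p : ℂ × ℂ) :
    Set.InjOn K.proj (Metric.ball p (K.radius / 2)) := by
  intro a ha b hb hab
  obtain ⟨g, hg, rfl⟩ := K.proj_eq_iff.1 hab
  have : g = 1 := K.eq_one_of_dist_lt hg (p := b) (by
    have h₁ := Metric.mem_ball.1 ha
    have h₂ := Metric.mem_ball'.1 hb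
    linarith [dist_triangle (g b) p b])
  simp [this]

/-- The projection restricted to a small ball, a homeomorphism onto an open subset. -/
noncomputable def localProj (K : KodairaData) (p : ℂ × ℂ) :
    OpenPartialHomeomorph (ℂ × ℂ) K.Surface :=
  OpenPartialHomeomorph.ofContinuousOpen ((K.injOn_proj p).toPartialEquiv _ _)
    K.continuous_proj.continuousOn K.isOpenMap_proj Metric.isOpen_ball

/-- The charts of the surface are the local inverses of the projection. -/
noncomputable instance (K : KodairaData) : ChartedSpace (ℂ × ℂ) K.Surface where
  atlas := Set.range fun p => (K.localProj p).symm
  chartAt x := (K.localProj (Function.surjInv K.proj_surjective x)).symm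
  mem_chart_source x := by
    exact ⟨Function.surjInv K.proj_surjective x, Metric.mem_ball_self (half_pos K.radius_pos),
      Function.surjInv_eq K.proj_surjective x⟩
  chart_mem_atlas _ := ⟨_, rfl⟩

/-- The surface is a complex manifold of dimension two. -/
instance (K : KodairaData) : IsManifold 𝓘(ℂ, ℂ × ℂ) ω K.Surface := by
  apply isManifold_of_contDiffOn
  rintro _ _ ⟨p, rfl⟩ ⟨q, rfl⟩ z hz
  have hsrc : z ∈ ((K.localProj p).trans (K.localProj q).symm).source := by simpa using hz
  rw [OpenPartialHomeomorph.trans_source] at hsrc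
  have hzq : K.proj z ∈ (K.localProj q).target := hsrc.2
  set w := (K.localProj q).symm (K.proj z) with hw
  have hwb : w ∈ Metric.ball q (K.radius / 2) := (K.localProj q).map_target hzq
  have hwz : K.proj w = K.proj z := (K.localProj q).right_inv hzq
  obtain ⟨g, hg, hgz⟩ := K.proj_eq_iff.1 hwz
  have hcg : ContDiff ℂ ω g := K.deckGroup_contDiff hg
  have hev : ∀ᶠ a in 𝓝 z, (K.localProj q).symm (K.proj a) = g a := by
    have : ∀ᶠ a in 𝓝 z, g a ∈ Metric.ball q (K.radius / 2) :=
      hcg.continuous.continuousAt.preimage_mem_nhds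
        (Metric.isOpen_ball.mem_nhds (by rw [hgz]; exact hwb))
    filter_upwards [this] with a ha
    have h₁ : K.proj a = K.proj (g a) := (K.proj_eq_iff.2 ⟨g, hg, rfl⟩).symm
    rw [h₁]
    exact (K.localProj q).left_inv ha
  have : ContDiffAt ℂ ω (fun a => (K.localProj q).symm (K.proj a)) z :=
    hcg.contDiffAt.congr_of_eventuallyEq hev
  exact this.contDiffWithinAt

/-- `ε = δ - c τ_B / 2`. -/
noncomputable def ε (K : KodairaData) : ℂ := K.δ - 1 / 2 * K.c * K.τB

/-- The form `D_{τ_B}`. -/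
noncomputable def D (K : KodairaData) (x y : ℂ) : ℂ := (tauForm K.τB x y : ℂ)

/-- The special self-map of `ℂ²` with parameters `α, β, σ, v`. -/
noncomputable def specialMap (K : KodairaData) (α β σ v : ℂ) (p : ℂ × ℂ) : ℂ × ℂ :=
  (α * p.1 + β,
    (‖α‖ : ℂ) ^ 2 * p.2 + 1 / 2 * K.D α 1 * K.c * α * p.1 ^ 2
      + (σ + K.D α 1 * (K.c * β + K.ε - 1 / 2 * K.D α K.τB * K.c)) * p.1 + v)

end KodairaData

/-!
A holomorphic self-map `f` of the quotient of `ℂ²` by the group `Π` generated by `γ₁, γ₂, γ₃, γ₄`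
lifts to a holomorphic map `F` of `ℂ²`, because the projection is a covering and `ℂ²` is simply
connected (`KodairaData.exists_differentiable_lift`). By uniqueness of lifts, for every `g` in `Π`
there is a `g'` in `Π` with `F ∘ g = g' ∘ F` (`KodairaData.exists_deck_comp_lift`). Elements of `Π`
are explicit affine maps, so the coordinates of `F` are changed by the four generators only by
affine functions of `z`. Liouville's theorem for doubly periodic entire functions, applied in `ζ`
for fixed `z` and then in `z` to the coefficients, shows that such a coordinate has the form
`μ ζ + A z² + B z + C` (`exists_eq_quadratic_of_quasi_periodic`). For the first coordinate the
relations for `γ₂` and `γ₁` leave only `α z + β`, as `c ≠ 0`. For the second one they determine `μ`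
and `A`; that `μ = |α|²` is the identity `conj α = m₁ - m₂ τ_B`, where `α = m₂ τ_B + n₂` and
`α τ_B = m₁ τ_B + n₁` (`conj_multiplier`). Surjectivity of `f` excludes `α = 0`.

Conversely, a special map descends exactly when it carries `Π`-orbits into `Π`-orbits, and for this
only the generators matter. Translations in `ζ` by `Λ_{τ_E}` go to translations by
`|α|² Λ_{τ_E} ⊆ Λ_{τ_E}`. Comparing the special map before and after `γ₂` and `γ₁` leaves one
translation in `ζ` for each, equal to `σ` and to `KodairaData.latticeDefect` up to integral
multiples of `c` (`KodairaData.specialMap_γ₂`, `KodairaData.specialMap_γ₁`). These must lie in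
`Λ_{τ_E}`, and this gives the two conditions.
-/

/-! ### Entire functions that are periodic up to polynomials -/

theorem exists_real_coord {τ : ℂ} (hτ : 0 < τ.im) (z : ℂ) : ∃ s t : ℝ, z = s * τ + t := by
  refine ⟨z.im / τ.im, z.re - z.im / τ.im * τ.re, ?_⟩
  apply Complex.ext
  · simp
  · simp [hτ.ne']

theorem int_coord_unique {τ : ℂ} (hτ : 0 < τ.im) {m n m' n' : ℤ}
    (h : (m : ℂ) * τ + n = m' * τ + n') : m = m' ∧ n = n' := by
  have him : (m : ℝ) * τ.im = m' * τ.im := by simpa using congrArg Complex.im h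
  have hm : m = m' := by exact_mod_cast mul_right_cancel₀ hτ.ne' him
  subst hm
  exact ⟨rfl, by exact_mod_cast add_left_cancel h⟩

/-- Liouville's theorem for doubly periodic entire functions: the values on a fundamental
parallelogram bound the function. -/
theorem eq_of_doubly_periodic {f : ℂ → ℂ} (hf : Differentiable ℂ f) {τ : ℂ}
    (hτ : 0 < τ.im) (h₁ : ∀ z, f (z + 1) = f z) (h₂ : ∀ z, f (z + τ) = f z) (z w : ℂ) :
    f z = f w := by
  refine hf.apply_eq_apply_of_bounded ?_ z w
  let φ : ℝ × ℝ → ℂ := fun p => f (p.1 * τ + p.2)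
  have hφ : Continuous φ := hf.continuous.comp (by fun_prop)
  refine (((isCompact_Icc (a := (0 : ℝ)) (b := 1)).prod
    (isCompact_Icc (a := (0 : ℝ)) (b := 1))).image hφ).isBounded.subset ?_
  rintro _ ⟨z, rfl⟩
  obtain ⟨s, t, rfl⟩ := exists_real_coord hτ z
  refine ⟨(Int.fract s, Int.fract t), ⟨⟨Int.fract_nonneg _, (Int.fract_lt_one _).le⟩,
    ⟨Int.fract_nonneg _, (Int.fract_lt_one _).le⟩⟩, ?_⟩
  have p₁ : Function.Periodic f 1 := h₁
  have p₂ : Function.Periodic f τ := h₂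
  have e₁ := p₁.int_mul ⌊t⌋ (((Int.fract s : ℝ) : ℂ) * τ + ((Int.fract t : ℝ) : ℂ))
  have e₂ := p₂.int_mul ⌊s⌋
    (((Int.fract s : ℝ) : ℂ) * τ + ((Int.fract t : ℝ) : ℂ) + ⌊t⌋ * 1)
  change f (((Int.fract s : ℝ) : ℂ) * τ + ((Int.fract t : ℝ) : ℂ)) = _
  rw [← e₁, ← e₂]
  congr 1
  rw [Int.fract, Int.fract]
  push_cast
  ring

theorem eq_affine_of_periodic_add_const {f : ℂ → ℂ} (hf : Differentiable ℂ f)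
    {τ : ℂ} (hτ : 0 < τ.im) {b₁ b₂ : ℂ} (h₁ : ∀ z, f (z + 1) = f z + b₁)
    (h₂ : ∀ z, f (z + τ) = f z + b₂) (z : ℂ) : f z = (f 1 - f 0) * z + f 0 := by
  have hd : Differentiable ℂ (deriv f) :=
    (hf.contDiff (n := 2)).differentiable_deriv_two
  have hper : ∀ b u : ℂ, (∀ z, f (z + u) = f z + b) → ∀ z, deriv f (z + u) = deriv f z := by
    intro b u h z
    rw [← deriv_comp_add_const, funext h, deriv_add_const]
  have hconst := eq_of_doubly_periodic hd hτ (hper _ _ h₁) (hper _ _ h₂)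
  -- The derivative is doubly periodic, hence constant.
  have hg : ∀ z, f z - deriv f 0 * z = f 0 := by
    intro z
    have hdg : Differentiable ℂ fun z => f z - deriv f 0 * z := by fun_prop
    have := is_const_of_deriv_eq_zero hdg (fun x => by
      rw [deriv_fun_sub (hf x) (by fun_prop), deriv_const_mul_field, deriv_id'', hconst x 0]
      ring) z 0
    simpa using this
  linear_combination hg z - z * hg 1

theorem eq_quadratic_of_periodic_add_affine {f : ℂ → ℂ} (hf : Differentiable ℂ f)
    {τ : ℂ} (hτ : 0 < τ.im) {a₁ b₁ a₂ b₂ : ℂ} (h₁ : ∀ z, f (z + 1) = f z + a₁ * z + b₁)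
    (h₂ : ∀ z, f (z + τ) = f z + a₂ * z + b₂) :
    ∃ A B C : ℂ, ∀ z, f z = A * z ^ 2 + B * z + C := by
  have hd : Differentiable ℂ (deriv f) :=
    (hf.contDiff (n := 2)).differentiable_deriv_two
  have hper : ∀ a b u : ℂ, (∀ z, f (z + u) = f z + a * z + b) →
      ∀ z, deriv f (z + u) = deriv f z + a := by
    intro a b u h z
    rw [← deriv_comp_add_const, funext h, deriv_add_const,
      deriv_fun_add (hf z) (by fun_prop), deriv_const_mul_field, deriv_id'', mul_one]
  have haff := eq_affine_of_periodic_add_const hd hτ (hper _ _ _ h₁) (hper _ _ _ h₂)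
  set a := deriv f 1 - deriv f 0
  set b := deriv f 0
  refine ⟨a / 2, b, f 0, fun z => ?_⟩
  have hdg : Differentiable ℂ fun z => f z - (a / 2 * z ^ 2 + b * z) := by fun_prop
  have := is_const_of_deriv_eq_zero hdg (fun x => by
    have h1 : HasDerivAt (fun z => f z - (a / 2 * z ^ 2 + b * z))
        (deriv f x - (a / 2 * (2 * x) + b * 1)) x := by
      refine (hf x).hasDerivAt.sub (HasDerivAt.add (HasDerivAt.const_mul _ ?_)
        ((hasDerivAt_id x).const_mul b))
      simpa using hasDerivAt_pow 2 x
    rw [h1.deriv, haff x]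
    ring) z 0
  simp only [ne_eq, OfNat.ofNat_ne_zero, not_false_eq_true, zero_pow, mul_zero, add_zero,
    sub_zero] at this
  linear_combination this

/-- A holomorphic function on `ℂ²` which the four generators of the group change only by affine
functions of `z` is affine in `ζ` with constant slope, and quadratic in `z`. Only one-variable
complex analysis is needed: first in `ζ` with `z` fixed, then in `z` for the coefficients. -/
theorem exists_eq_quadratic_of_quasi_periodic {G : ℂ × ℂ → ℂ} (hG : Differentiable ℂ G)
    {τB τE c δ : ℂ} (hB : 0 < τB.im) (hE : 0 < τE.im) {a₁ b₁ a₂ b₂ b₃ b₄ : ℂ}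
    (h₁ : ∀ z ζ, G (z + τB, ζ + c * z + δ) = G (z, ζ) + a₁ * z + b₁)
    (h₂ : ∀ z ζ, G (z + 1, ζ) = G (z, ζ) + a₂ * z + b₂)
    (h₃ : ∀ z ζ, G (z, ζ + τE) = G (z, ζ) + b₃)
    (h₄ : ∀ z ζ, G (z, ζ + 1) = G (z, ζ) + b₄) :
    ∃ μ A B C : ℂ, ∀ z ζ, G (z, ζ) = μ * ζ + A * z ^ 2 + B * z + C := by
  have hζ : ∀ z ζ, G (z, ζ) = (G (z, 1) - G (z, 0)) * ζ + G (z, 0) := fun z =>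
    eq_affine_of_periodic_add_const (f := fun ζ => G (z, ζ))
      (hG.comp (by fun_prop)) hE (h₄ z) (h₃ z)
  have hd : ∀ ζ, Differentiable ℂ fun z => G (z, ζ) := fun ζ => hG.comp (by fun_prop)
  have hslope : ∀ z, G (z, 1) - G (z, 0) = G (0, 1) - G (0, 0) := by
    intro z
    refine eq_of_doubly_periodic (f := fun z => G (z, 1) - G (z, 0))
      ((hd 1).sub (hd 0)) hB (fun z => ?_) (fun z => ?_) z 0
    · simp only [h₂]; ring
    -- The values of `ζ` are chosen so that `γ₁` moves them to `0` and `1`.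
    · have e₀ := h₁ z (-c * z - δ)
      have e₁ := h₁ z (1 - c * z - δ)
      rw [hζ z, show -c * z - δ + c * z + δ = 0 by ring] at e₀
      rw [hζ z, show 1 - c * z - δ + c * z + δ = 1 by ring] at e₁
      change G (z + τB, 1) - G (z + τB, 0) = _
      rw [e₀, e₁]; ring
  set μ := G (0, 1) - G (0, 0)
  have hG' : ∀ z ζ, G (z, ζ) = μ * ζ + G (z, 0) := fun z ζ => by rw [hζ z ζ, hslope]
  obtain ⟨A, B, C, h⟩ := eq_quadratic_of_periodic_add_affine (hd 0) hB (fun z => h₂ z 0)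
    (a₂ := a₁ - μ * c) (b₂ := b₁ - μ * δ) (fun z => by
      have := h₁ z 0
      rw [hG'] at this
      linear_combination this)
  refine ⟨μ, A, B, C, fun z ζ => ?_⟩
  rw [hG', h]; ring

/-! ### Multipliers of a lattice -/

theorem mul_conj_eq_norm_sq (α : ℂ) : α * conj α = (‖α‖ : ℂ) ^ 2 := by
  rw [Complex.mul_conj, Complex.normSq_eq_norm_sq]; push_cast; rfl

/-- If `α = m₂ τ + n₂` and `α τ = m₁ τ + n₁`, the conjugate of `α` is `m₁ - m₂ τ`: the matrix of
multiplication by `α` has trace `α + conj α`. -/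
theorem conj_multiplier {τ α : ℂ} (hτ : 0 < τ.im) {m₁ n₁ m₂ n₂ : ℤ} (h₂ : α = m₂ * τ + n₂)
    (h₁ : α * τ = m₁ * τ + n₁) : conj α = m₁ - m₂ * τ ∧ (m₂ : ℂ) * (‖τ‖ : ℂ) ^ 2 = -n₁ := by
  subst h₂
  have him := congrArg Complex.im h₁
  have hre := congrArg Complex.re h₁
  simp only [Complex.mul_im, Complex.mul_re, Complex.add_im, Complex.add_re, Complex.intCast_re,
    Complex.intCast_im, zero_mul, add_zero, sub_zero] at him hre
  have htr : 2 * (m₂ : ℝ) * τ.re + n₂ = m₁ := by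
    apply mul_right_cancel₀ hτ.ne'
    linear_combination him
  refine ⟨?_, ?_⟩
  · apply Complex.ext
    · simp; linear_combination htr
    · simp
  · rw [← mul_conj_eq_norm_sq]
    apply Complex.ext
    · simp; linear_combination -hre + τ.re * htr
    · simp; exact Or.inr (by ring)

/-! ### The covering by `ℂ²` -/

namespace KodairaData

variable (K : KodairaData)

theorem γ₁_zpow_apply (m : ℤ) (z ζ : ℂ) : (K.γ₁ ^ m) (z, ζ) =
    (z + m * K.τB, ζ + m * K.c * z + (m * K.δ + m * (m - 1) / 2 * K.c * K.τB)) := by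
  induction m using Int.induction_on generalizing z ζ with
  | zero => simp
  | succ m ih =>
    rw [zpow_add_one, Equiv.Perm.mul_apply]
    change (K.γ₁ ^ (m : ℤ)) (z + K.τB, ζ + K.c * z + K.δ) = _
    rw [ih]
    ext <;> push_cast <;> ring
  | pred m ih =>
    rw [zpow_sub_one, Equiv.Perm.mul_apply]
    change (K.γ₁ ^ (-m : ℤ)) (z - K.τB, ζ - K.c * (z - K.τB) - K.δ) = _
    rw [ih]
    ext <;> push_cast <;> ring

theorem γ₂_zpow_apply (m : ℤ) (z ζ : ℂ) : (K.γ₂ ^ m) (z, ζ) = (z + m, ζ) := by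
  induction m using Int.induction_on generalizing z ζ with
  | zero => simp
  | succ m ih =>
    rw [zpow_add_one, Equiv.Perm.mul_apply]
    change (K.γ₂ ^ (m : ℤ)) (z + 1, ζ) = _
    rw [ih]
    ext <;> push_cast <;> ring
  | pred m ih =>
    rw [zpow_sub_one, Equiv.Perm.mul_apply]
    change (K.γ₂ ^ (-m : ℤ)) (z - 1, ζ) = _
    rw [ih]
    ext <;> push_cast <;> ring

theorem γ₃_zpow_apply (m : ℤ) (z ζ : ℂ) : (K.γ₃ ^ m) (z, ζ) = (z, ζ + m * K.τE) := by
  induction m using Int.induction_on generalizing z ζ with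
  | zero => simp
  | succ m ih =>
    rw [zpow_add_one, Equiv.Perm.mul_apply]
    change (K.γ₃ ^ (m : ℤ)) (z, ζ + K.τE) = _
    rw [ih]
    ext <;> push_cast <;> ring
  | pred m ih =>
    rw [zpow_sub_one, Equiv.Perm.mul_apply]
    change (K.γ₃ ^ (-m : ℤ)) (z, ζ - K.τE) = _
    rw [ih]
    ext <;> push_cast <;> ring

theorem γ₄_zpow_apply (m : ℤ) (z ζ : ℂ) : (K.γ₄ ^ m) (z, ζ) = (z, ζ + m) := by
  induction m using Int.induction_on generalizing z ζ with
  | zero => simp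
  | succ m ih =>
    rw [zpow_add_one, Equiv.Perm.mul_apply]
    change (K.γ₄ ^ (m : ℤ)) (z, ζ + 1) = _
    rw [ih]
    ext <;> push_cast <;> ring
  | pred m ih =>
    rw [zpow_sub_one, Equiv.Perm.mul_apply]
    change (K.γ₄ ^ (-m : ℤ)) (z, ζ - 1) = _
    rw [ih]
    ext <;> push_cast <;> ring

theorem γ₁_mem : K.γ₁ ∈ K.deckGroup := Subgroup.subset_closure (by simp)

theorem γ₂_mem : K.γ₂ ∈ K.deckGroup := Subgroup.subset_closure (by simp)

theorem γ₃_mem : K.γ₃ ∈ K.deckGroup := Subgroup.subset_closure (by simp)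

theorem γ₄_mem : K.γ₄ ∈ K.deckGroup := Subgroup.subset_closure (by simp)

/-- The converse of `deckGroup_form`: every map of that affine form belongs to the group. -/
theorem exists_mem_deckGroup (m n : ℤ) {y : ℂ} (hy : y ∈ tauLattice K.τE) :
    ∃ g ∈ K.deckGroup, ∀ z ζ : ℂ, g (z, ζ) = (z + (m * K.τB + n),
      ζ + m * K.c * z + (m * K.δ + m * (m - 1) / 2 * K.c * K.τB + y)) := by
  obtain ⟨k, l, rfl⟩ := mem_tauLattice.1 hy
  refine ⟨K.γ₂ ^ n * (K.γ₃ ^ k * (K.γ₄ ^ l * K.γ₁ ^ m)),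
    mul_mem (zpow_mem K.γ₂_mem _) (mul_mem (zpow_mem K.γ₃_mem _)
      (mul_mem (zpow_mem K.γ₄_mem _) (zpow_mem K.γ₁_mem _))), fun z ζ => ?_⟩
  simp only [Equiv.Perm.mul_apply, γ₁_zpow_apply, γ₂_zpow_apply, γ₃_zpow_apply, γ₄_zpow_apply]
  ext <;> ring

theorem proj_eq_iff_coord {z ζ z' ζ' : ℂ} : K.proj (z', ζ') = K.proj (z, ζ) ↔
    ∃ m n : ℤ, ∃ y ∈ tauLattice K.τE, z' = z + (m * K.τB + n) ∧
      ζ' = ζ + m * K.c * z + (m * K.δ + m * (m - 1) / 2 * K.c * K.τB + y) := by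
  rw [proj_eq_iff]
  constructor
  · rintro ⟨g, hg, h⟩
    obtain ⟨m, n, y, hy, hf⟩ := K.deckGroup_form hg
    rw [hf] at h
    exact ⟨m, n, y, hy, (congrArg Prod.fst h).symm, (congrArg Prod.snd h).symm⟩
  · rintro ⟨m, n, y, hy, rfl, rfl⟩
    obtain ⟨g, hg, hf⟩ := K.exists_mem_deckGroup m n hy
    exact ⟨g, hg, hf z ζ⟩

theorem isQuotientCoveringMap_proj : IsQuotientCoveringMap K.proj K.deckGroup where
  toIsQuotientMap := isQuotientMap_quotient_mk'
  continuous_const_smul := continuous_const_smul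
  apply_eq_iff_mem_orbit {_ _} := Quotient.eq (r := MulAction.orbitRel K.deckGroup (ℂ × ℂ))
  disjoint e := by
    refine ⟨Metric.ball e (K.radius / 2), Metric.ball_mem_nhds _ (half_pos K.radius_pos), ?_⟩
    rintro g ⟨_, ⟨u, hu, rfl⟩, hgu⟩
    apply Subtype.ext
    refine K.eq_one_of_dist_lt g.2 (p := u) ?_
    have h₁ := Metric.mem_ball.1 hgu
    have h₂ := Metric.mem_ball'.1 hu
    change dist (g.1 u) e < _ at h₁
    linarith [dist_triangle (g.1 u) e u]

theorem localProj_symm_mem_maximalAtlas (p : ℂ × ℂ) :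
    (K.localProj p).symm ∈ IsManifold.maximalAtlas 𝓘(ℂ, ℂ × ℂ) ω K.Surface :=
  IsManifold.subset_maximalAtlas ⟨p, rfl⟩

theorem contMDiff_proj : ContMDiff 𝓘(ℂ, ℂ × ℂ) 𝓘(ℂ, ℂ × ℂ) ω K.proj := fun p =>
  contMDiffAt_symm_of_mem_maximalAtlas (K.localProj_symm_mem_maximalAtlas p)
    (Metric.mem_ball_self (half_pos K.radius_pos))

theorem contMDiffAt_localProj_symm (p : ℂ × ℂ) :
    ContMDiffAt 𝓘(ℂ, ℂ × ℂ) 𝓘(ℂ, ℂ × ℂ) ω (K.localProj p).symm (K.proj p) :=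
  contMDiffAt_of_mem_maximalAtlas (K.localProj_symm_mem_maximalAtlas p)
    ((K.localProj p).map_source (Metric.mem_ball_self (half_pos K.radius_pos)))

theorem localProj_symm_proj {p q : ℂ × ℂ} (h : q ∈ Metric.ball p (K.radius / 2)) :
    (K.localProj p).symm (K.proj q) = q :=
  (K.localProj p).left_inv h

/-- A holomorphic self-map of the surface lifts to the universal covering. -/
theorem exists_differentiable_lift {f : K.Surface → K.Surface}
    (hf : MDifferentiable 𝓘(ℂ, ℂ × ℂ) 𝓘(ℂ, ℂ × ℂ) f) :
    ∃ F : ℂ × ℂ → ℂ × ℂ, Differentiable ℂ F ∧ ∀ p, K.proj (F p) = f (K.proj p) := by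
  obtain ⟨e₀, he₀⟩ := K.proj_surjective (f (K.proj 0))
  obtain ⟨F, ⟨-, hF⟩, -⟩ :=
    K.isQuotientCoveringMap_proj.isCoveringMap.existsUnique_continuousMap_lifts
      (⟨fun p => f (K.proj p), hf.continuous.comp K.continuous_proj⟩ : C(ℂ × ℂ, K.Surface)) 0 e₀ he₀
  have hF' : ∀ p, K.proj (F p) = f (K.proj p) := fun p => congrFun hF p
  refine ⟨F, fun p => ?_, hF'⟩
  rw [← mdifferentiableAt_iff_differentiableAt]
  have hcomp : MDifferentiableAt 𝓘(ℂ, ℂ × ℂ) 𝓘(ℂ, ℂ × ℂ)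
      (fun q => (K.localProj (F p)).symm (f (K.proj q))) p := by
    have h₁ : MDifferentiableAt 𝓘(ℂ, ℂ × ℂ) 𝓘(ℂ, ℂ × ℂ) (K.localProj (F p)).symm
        (f (K.proj p)) := by
      rw [← hF']
      exact (K.contMDiffAt_localProj_symm (F p)).mdifferentiableAt (by simp)
    exact h₁.comp p ((hf (K.proj p)).comp p
      (K.contMDiff_proj.contMDiffAt.mdifferentiableAt (by simp)))
  refine hcomp.congr_of_eventuallyEq ?_
  filter_upwards [F.continuous.continuousAt.preimage_mem_nhds
    (Metric.ball_mem_nhds (F p) (half_pos K.radius_pos))] with q hq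
  rw [← hF', K.localProj_symm_proj hq]

/-- A lift carries deck transformations to deck transformations. -/
theorem exists_deck_comp_lift {f : K.Surface → K.Surface} {F : ℂ × ℂ → ℂ × ℂ} (hF : Continuous F)
    (h : ∀ p, K.proj (F p) = f (K.proj p)) {g : Equiv.Perm (ℂ × ℂ)} (hg : g ∈ K.deckGroup) :
    ∃ g' ∈ K.deckGroup, ∀ p, F (g p) = g' (F p) := by
  have hpg : ∀ {g : Equiv.Perm (ℂ × ℂ)}, g ∈ K.deckGroup → ∀ p, K.proj (g p) = K.proj p :=
    fun hg p => K.proj_eq_iff.2 ⟨_, hg, rfl⟩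
  obtain ⟨g', hg', h0⟩ := K.proj_eq_iff.1 (show K.proj (F (g 0)) = K.proj (F 0) by
    rw [h, h, hpg hg])
  refine ⟨g', hg', fun p => ?_⟩
  refine congrFun (K.isQuotientCoveringMap_proj.isCoveringMap.eq_of_comp_eq
    (g₁ := fun p => F (g p)) (g₂ := fun p => g' (F p))
    (hF.comp (K.deckGroup_contDiff hg).continuous)
    ((K.deckGroup_contDiff hg').continuous.comp hF) ?_ 0 h0.symm) p
  funext q
  simp only [Function.comp_apply]
  rw [hpg hg', h, h, hpg hg]

/-! ### The coefficients of the special maps -/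

/-- The complex number whose membership in `Λ_{τ_E}` is the second condition for a special map to
descend. By `specialMap_γ₁` it is, up to an integral multiple of `c`, the translation in `ζ` that
remains when the special map is compared before and after `γ₁`. -/
noncomputable def latticeDefect (α β σ : ℂ) : ℂ :=
  σ * K.τB - conj α * (K.c * β + (1 - α) * K.ε)
    + 1 / 2 * K.c * K.D α 1 *
      (K.D (α * K.τB) 1 * (‖(K.τB : ℂ)‖ : ℂ) ^ 2 - K.D α K.τB * K.τB)

variable {K} {α : ℂ} {m₁ n₁ m₂ n₂ : ℤ}

theorem D_one_of_eq (h₂ : α = m₂ * K.τB + n₂) : K.D α 1 = m₂ := by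
  have := tauForm_coord K.τB.im_pos m₂ n₂ 0 1
  simp only [Int.cast_zero, zero_mul, zero_add, Int.cast_one, mul_one, mul_zero, sub_zero] at this
  rw [D, h₂]
  exact_mod_cast congrArg ((↑) : ℝ → ℂ) this

theorem D_τB_of_eq (h₂ : α = m₂ * K.τB + n₂) : K.D α K.τB = -n₂ := by
  have := tauForm_coord K.τB.im_pos m₂ n₂ 1 0
  simp only [Int.cast_zero, add_zero, Int.cast_one, mul_one, mul_zero, one_mul, zero_sub] at this
  rw [D, h₂]
  exact_mod_cast congrArg ((↑) : ℝ → ℂ) this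

theorem norm_sq_of_eq (h₂ : α = m₂ * K.τB + n₂) (h₁ : α * K.τB = m₁ * K.τB + n₁) :
    (‖α‖ : ℂ) ^ 2 = ((n₂ * m₁ - m₂ * n₁ : ℤ) : ℂ) := by
  rw [← mul_conj_eq_norm_sq, (conj_multiplier K.τB.im_pos h₂ h₁).1]
  push_cast
  linear_combination m₁ * h₂ - m₂ * h₁

/-- The image of `γ₂ (z, ζ)` is obtained from the image of `(z, ζ)` by a map of the form of
`KodairaData.deckGroup_form`, except that the translation `σ + m₂ n₂ c` need not lie in `Λ_{τ_E}`.
It does so precisely when `σ` does. -/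
theorem specialMap_γ₂ (h₂ : α = m₂ * K.τB + n₂) (β σ v z ζ : ℂ) :
    K.specialMap α β σ v (K.γ₂ (z, ζ)) =
      ((α * z + β) + (m₂ * K.τB + n₂), (K.specialMap α β σ v (z, ζ)).2 + m₂ * K.c * (α * z + β)
        + (m₂ * K.δ + m₂ * (m₂ - 1) / 2 * K.c * K.τB + (σ + m₂ * n₂ * K.c))) := by
  change K.specialMap α β σ v (z + 1, ζ) = _
  simp only [specialMap, D_one_of_eq h₂, D_τB_of_eq h₂, ε]
  ext
  · simp only; linear_combination h₂
  · simp only; linear_combination (m₂ * K.c / 2) * h₂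

/-- The analogue of `specialMap_γ₂` for `γ₁`. Here the translation is `latticeDefect + m₁ n₁ c`;
the correction by `m₁ n₁ c` comes from `m₂ |τ_B|² = -n₁`. -/
theorem specialMap_γ₁ (h₂ : α = m₂ * K.τB + n₂) (h₁ : α * K.τB = m₁ * K.τB + n₁)
    (β σ v z ζ : ℂ) :
    K.specialMap α β σ v (K.γ₁ (z, ζ)) =
      ((α * z + β) + (m₁ * K.τB + n₁), (K.specialMap α β σ v (z, ζ)).2 + m₁ * K.c * (α * z + β)
        + (m₁ * K.δ + m₁ * (m₁ - 1) / 2 * K.c * K.τB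
          + (K.latticeDefect α β σ + m₁ * n₁ * K.c))) := by
  obtain ⟨hc, hN⟩ := conj_multiplier K.τB.im_pos h₂ h₁
  change K.specialMap α β σ v (z + K.τB, ζ + K.c * z + K.δ) = _
  simp only [specialMap, latticeDefect, D_one_of_eq h₂, D_τB_of_eq h₂, D_one_of_eq h₁, ε,
    ← mul_conj_eq_norm_sq α, hc]
  ext
  · simp only; linear_combination h₁
  · simp only
    -- Integrality of `α τ_B` is the quadratic equation of `τ_B`.
    have hn : (n₁ : ℂ) = (m₂ * K.τB + n₂) * K.τB - m₁ * K.τB := by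
      rw [← h₂]; linear_combination -h₁
    subst h₂
    linear_combination (-(K.c * m₁ / 2)) * hN - (K.c * m₁ / 2) * hn

variable (K)

/-- A special map with nonzero `α`, as an automorphism of the complex manifold `ℂ²`. -/
noncomputable def specialDiffeomorph (hα : α ≠ 0) (β σ v : ℂ) :
    (ℂ × ℂ) ≃ₘ^ω⟮𝓘(ℂ, ℂ × ℂ), 𝓘(ℂ, ℂ × ℂ)⟯ (ℂ × ℂ) where
  toFun := K.specialMap α β σ v
  invFun p := ((p.1 - β) / α,
    (p.2 - 1 / 2 * K.D α 1 * K.c * α * ((p.1 - β) / α) ^ 2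
      - (σ + K.D α 1 * (K.c * β + K.ε - 1 / 2 * K.D α K.τB * K.c)) * ((p.1 - β) / α) - v)
      / (‖α‖ : ℂ) ^ 2)
  left_inv p := by
    have hn : (‖α‖ : ℂ) ≠ 0 := by simpa using hα
    have h : (α * p.1 + β - β) / α = p.1 := by field_simp; ring
    simp only [specialMap, h]
    ext
    · rfl
    · simp only; field_simp; ring
  right_inv p := by
    have hn : (‖α‖ : ℂ) ≠ 0 := by simpa using hα
    simp only [specialMap]
    ext
    · simp only; field_simp; ring
    · simp only
      rw [mul_div_cancel₀ _ (pow_ne_zero 2 hn)]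
      ring
  contMDiff_toFun := by
    refine ContDiff.contMDiff (f := K.specialMap α β σ v) ?_
    unfold specialMap
    fun_prop
  contMDiff_invFun := by
    refine ContDiff.contMDiff (f := fun p : ℂ × ℂ => ((p.1 - β) / α,
      (p.2 - 1 / 2 * K.D α 1 * K.c * α * ((p.1 - β) / α) ^ 2
        - (σ + K.D α 1 * (K.c * β + K.ε - 1 / 2 * K.D α K.τB * K.c)) * ((p.1 - β) / α) - v)
        / (‖α‖ : ℂ) ^ 2)) ?_
    fun_prop

/-! ### Descending special maps -/

theorem exists_multiplier_coord (hΛ : ∀ x ∈ tauLattice K.τB, α * x ∈ tauLattice K.τB) :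
    ∃ m₁ n₁ m₂ n₂ : ℤ, α = m₂ * K.τB + n₂ ∧ α * K.τB = m₁ * K.τB + n₁ := by
  obtain ⟨m₁, n₁, h₁⟩ := mem_tauLattice.1 (hΛ K.τB (mem_tauLattice.2 ⟨1, 0, by simp⟩))
  obtain ⟨m₂, n₂, h₂⟩ := mem_tauLattice.1 (hΛ 1 (mem_tauLattice.2 ⟨0, 1, by simp⟩))
  exact ⟨m₁, n₁, m₂, n₂, by simpa using h₂, h₁⟩

/-- A map of `ℂ²` that sends each point and its translates by the four generators to the same
orbit is compatible with the projection. -/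
theorem proj_eq_of_generators {Φ : ℂ × ℂ → ℂ × ℂ}
    (h₁ : ∀ p, K.proj (Φ (K.γ₁ p)) = K.proj (Φ p)) (h₂ : ∀ p, K.proj (Φ (K.γ₂ p)) = K.proj (Φ p))
    (h₃ : ∀ p, K.proj (Φ (K.γ₃ p)) = K.proj (Φ p)) (h₄ : ∀ p, K.proj (Φ (K.γ₄ p)) = K.proj (Φ p))
    {p q : ℂ × ℂ} (hpq : K.proj p = K.proj q) : K.proj (Φ p) = K.proj (Φ q) := by
  obtain ⟨g, hg, rfl⟩ := K.proj_eq_iff.1 hpq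
  clear hpq
  unfold deckGroup at hg
  induction hg using Subgroup.closure_induction generalizing q with
  | mem g hg => rcases hg with rfl | rfl | rfl | rfl <;> apply_assumption
  | one => rfl
  | mul g h _ _ ihg ihh => rw [Equiv.Perm.mul_apply, ihg, ihh]
  | inv g _ ih => rw [← ih (q := g⁻¹ q), ← Equiv.Perm.mul_apply, mul_inv_cancel, Equiv.Perm.one_apply]

/-- A holomorphic map of `ℂ²` compatible with the projection descends to the surface. -/
theorem exists_descent {Φ : ℂ × ℂ → ℂ × ℂ} (hΦ : ContDiff ℂ ω Φ)
    (h : ∀ p q, K.proj p = K.proj q → K.proj (Φ p) = K.proj (Φ q)) :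
    ∃ f : K.Surface → K.Surface, MDifferentiable 𝓘(ℂ, ℂ × ℂ) 𝓘(ℂ, ℂ × ℂ) f ∧
      ∀ p, K.proj (Φ p) = f (K.proj p) := by
  have hs := Function.surjInv_eq K.proj_surjective
  set f : K.Surface → K.Surface := fun x => K.proj (Φ (Function.surjInv K.proj_surjective x))
    with hf
  have hfp : ∀ p, K.proj (Φ p) = f (K.proj p) := fun p => h _ _ (hs _).symm
  refine ⟨f, fun x => ?_, hfp⟩
  obtain ⟨p, rfl⟩ := K.proj_surjective x
  have hp : p ∈ Metric.ball p (K.radius / 2) := Metric.mem_ball_self (half_pos K.radius_pos)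
  have hcomp : ContMDiffAt 𝓘(ℂ, ℂ × ℂ) 𝓘(ℂ, ℂ × ℂ) ω
      (fun y => K.proj (Φ ((K.localProj p).symm y))) (K.proj p) :=
    (K.contMDiff_proj.comp hΦ.contMDiff).contMDiffAt.comp _ (K.contMDiffAt_localProj_symm p)
  refine (hcomp.congr_of_eventuallyEq ?_).mdifferentiableAt (by simp)
  have hopen : (K.localProj p).target ∈ 𝓝 (K.proj p) :=
    (K.localProj p).open_target.mem_nhds ((K.localProj p).map_source hp)
  filter_upwards [hopen] with y hy
  rw [hfp]
  congr 1
  exact ((K.localProj p).right_inv hy).symm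

/-- Both conditions read off the translations in `specialMap_γ₁` and `specialMap_γ₂`: necessity
follows by evaluation at the origin, and sufficiency by checking the four generators. -/
theorem specialMap_descends_iff (hα : α ≠ 0)
    (hΛ : ∀ x ∈ tauLattice K.τB, α * x ∈ tauLattice K.τB) (β σ v : ℂ) :
    (∃ f : K.Surface → K.Surface, MDifferentiable 𝓘(ℂ, ℂ × ℂ) 𝓘(ℂ, ℂ × ℂ) f ∧
      Function.Surjective f ∧ ∀ p, K.proj (K.specialMap α β σ v p) = f (K.proj p)) ↔
    σ ∈ tauLattice K.τE ∧ K.latticeDefect α β σ ∈ tauLattice K.τE := by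
  obtain ⟨m₁, n₁, m₂, n₂, h₂, h₁⟩ := K.exists_multiplier_coord hΛ
  have hcm : ∀ m n : ℤ, (m : ℂ) * n * K.c ∈ tauLattice K.τE := fun m n => by
    simpa [zsmul_eq_mul] using zsmul_mem K.c_mem (m * n)
  constructor
  · rintro ⟨f, -, -, hf⟩
    have hγ : ∀ g ∈ K.deckGroup, K.proj (K.specialMap α β σ v (g (0, 0))) =
        K.proj (K.specialMap α β σ v (0, 0)) := fun g hg => by
      rw [hf, hf, K.proj_eq_iff.2 ⟨g, hg, rfl⟩]
    have hfst : K.specialMap α β σ v (0, 0) =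
        (α * 0 + β, (K.specialMap α β σ v (0, 0)).2) := rfl
    constructor
    · have h := hγ _ K.γ₂_mem
      rw [specialMap_γ₂ h₂, hfst, proj_eq_iff_coord] at h
      obtain ⟨m, n, y, hy, e₁, e₂⟩ := h
      obtain ⟨rfl, rfl⟩ := int_coord_unique K.τB.im_pos (add_left_cancel e₁)
      rw [← add_left_cancel (add_left_cancel e₂)] at hy
      simpa using sub_mem hy (hcm m₂ n₂)
    · have h := hγ _ K.γ₁_mem
      rw [specialMap_γ₁ h₂ h₁, hfst, proj_eq_iff_coord] at h
      obtain ⟨m, n, y, hy, e₁, e₂⟩ := h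
      obtain ⟨rfl, rfl⟩ := int_coord_unique K.τB.im_pos (add_left_cancel e₁)
      rw [← add_left_cancel (add_left_cancel e₂)] at hy
      simpa using sub_mem hy (hcm m₁ n₁)
  · rintro ⟨hσ, hd⟩
    -- The translations in `ζ` are multiplied by the integer `|α|² = n₂ m₁ - m₂ n₁`.
    have hvert : ∀ y ∈ tauLattice K.τE, ∀ z ζ, K.proj (K.specialMap α β σ v (z, ζ + y)) =
        K.proj (K.specialMap α β σ v (z, ζ)) := by
      intro y hy z ζ
      refine K.proj_eq_iff_coord.2 ⟨0, 0, (n₂ * m₁ - m₂ * n₁) • y, zsmul_mem hy _, ?_, ?_⟩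
      · simp
      · simp only [norm_sq_of_eq h₂ h₁, zsmul_eq_mul]; push_cast; ring
    have hdesc := fun p q => K.proj_eq_of_generators (Φ := K.specialMap α β σ v) (p := p) (q := q)
      (fun ⟨z, ζ⟩ => by
        rw [specialMap_γ₁ h₂ h₁]
        exact K.proj_eq_iff_coord.2 ⟨m₁, n₁, _, add_mem hd (hcm m₁ n₁), rfl, rfl⟩)
      (fun ⟨z, ζ⟩ => by
        rw [specialMap_γ₂ h₂]
        exact K.proj_eq_iff_coord.2 ⟨m₂, n₂, _, add_mem hσ (hcm m₂ n₂), rfl, rfl⟩)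
      (fun ⟨z, ζ⟩ => hvert _ (mem_tauLattice.2 ⟨1, 0, by simp⟩) z ζ)
      (fun ⟨z, ζ⟩ => hvert _ (mem_tauLattice.2 ⟨0, 1, by simp⟩) z ζ)
    obtain ⟨f, hf, hfp⟩ := K.exists_descent
      (K.specialDiffeomorph hα β σ v).contMDiff.contDiff hdesc
    refine ⟨f, hf, fun x => ?_, hfp⟩
    obtain ⟨p, rfl⟩ := K.proj_surjective x
    obtain ⟨q, rfl⟩ := (K.specialDiffeomorph hα β σ v).surjective p
    exact ⟨K.proj q, (hfp q).symm⟩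

/-! ### The shape of a lift -/

/-- A holomorphic map of `ℂ²` which carries deck transformations to deck transformations has
first coordinate depending on `z` only, and affinely: its slope in `ζ` vanishes since `c ≠ 0`. -/
theorem exists_fst_eq_affine {F : ℂ × ℂ → ℂ × ℂ} (hF : Differentiable ℂ F)
    (hdeck : ∀ g ∈ K.deckGroup, ∃ g' ∈ K.deckGroup, ∀ p, F (g p) = g' (F p)) :
    ∃ α β : ℂ, ∀ z ζ, (F (z, ζ)).1 = α * z + β := by
  have hfst : ∀ g ∈ K.deckGroup, ∃ b : ℂ, ∀ p, (F (g p)).1 = (F p).1 + b := by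
    intro g hg
    obtain ⟨g', hg', h⟩ := hdeck g hg
    obtain ⟨m, n, y, -, hf⟩ := K.deckGroup_form hg'
    exact ⟨m * K.τB + n, fun p => by rw [h, ← Prod.mk.eta (p := F p), hf]⟩
  obtain ⟨b₁, hb₁⟩ := hfst _ K.γ₁_mem
  obtain ⟨b₂, hb₂⟩ := hfst _ K.γ₂_mem
  obtain ⟨b₃, hb₃⟩ := hfst _ K.γ₃_mem
  obtain ⟨b₄, hb₄⟩ := hfst _ K.γ₄_mem
  have h₁ : ∀ z ζ, (F (z + K.τB, ζ + K.c * z + K.δ)).1 = (F (z, ζ)).1 + b₁ := fun z ζ => hb₁ (z, ζ)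
  have h₂ : ∀ z ζ, (F (z + 1, ζ)).1 = (F (z, ζ)).1 + b₂ := fun z ζ => hb₂ (z, ζ)
  obtain ⟨μ, A, B, C, h⟩ := exists_eq_quadratic_of_quasi_periodic (G := fun p => (F p).1)
    (a₁ := 0) (b₁ := b₁) (a₂ := 0) (b₂ := b₂) hF.fst
    K.τB.im_pos K.τE.im_pos (fun z ζ => by simpa using h₁ z ζ) (fun z ζ => by simpa using h₂ z ζ)
    (fun z ζ => hb₃ (z, ζ)) (fun z ζ => hb₄ (z, ζ))
  simp only [h] at h₁ h₂
  -- Compare the coefficients of `z` in the relations for `γ₂` and `γ₁`.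
  have hA : A = 0 := by linear_combination (h₂ 1 0 - h₂ 0 0) / 2
  have hμ : μ = 0 := by
    have : μ * K.c = 0 := by linear_combination (h₁ 1 0 - h₁ 0 0) - 2 * K.τB * hA
    exact (mul_eq_zero.1 this).resolve_right K.c_ne_zero
  exact ⟨B, C, fun z ζ => by rw [h, hA, hμ]; ring⟩

/-- The coefficients of a lift are determined by the deck transformations to which it carries
`γ₁` and `γ₂`. -/
theorem exists_eq_specialMap {F : ℂ × ℂ → ℂ × ℂ} (hF : Differentiable ℂ F)
    (hdeck : ∀ g ∈ K.deckGroup, ∃ g' ∈ K.deckGroup, ∀ p, F (g p) = g' (F p)) :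
    ∃ α β σ v : ℂ, (∃ m₁ n₁ m₂ n₂ : ℤ, α = m₂ * K.τB + n₂ ∧ α * K.τB = m₁ * K.τB + n₁) ∧
      ∀ p, F p = K.specialMap α β σ v p := by
  obtain ⟨α, β, hfst⟩ := K.exists_fst_eq_affine hF hdeck
  have hcoord : ∀ g ∈ K.deckGroup, ∃ m n : ℤ, ∃ y : ℂ, ∀ p,
      (F (g p)).1 = (F p).1 + (m * K.τB + n) ∧ (F (g p)).2 = (F p).2 + m * K.c * (F p).1 +
        (m * K.δ + m * (m - 1) / 2 * K.c * K.τB + y) := by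
    intro g hg
    obtain ⟨g', hg', h⟩ := hdeck g hg
    obtain ⟨m, n, y, -, hf⟩ := K.deckGroup_form hg'
    exact ⟨m, n, y, fun p => by rw [h, ← Prod.mk.eta (p := F p), hf]; exact ⟨rfl, rfl⟩⟩
  -- A translation in `ζ` does not move the first coordinate of `F`, so it goes to a translation.
  have hvert : ∀ g ∈ K.deckGroup, (∀ p, (g p).1 = p.1) → ∃ b : ℂ, ∀ p,
      (F (g p)).2 = (F p).2 + b := by
    intro g hg hz
    obtain ⟨m, n, y, h⟩ := hcoord g hg
    have h0 := (h 0).1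
    rw [← Prod.mk.eta (p := g 0), hz 0, ← Prod.mk.eta (p := (0 : ℂ × ℂ)), hfst, hfst] at h0
    obtain ⟨rfl, rfl⟩ := int_coord_unique (m := m) (n := n) (m' := 0) (n' := 0) K.τB.im_pos
      (by push_cast; linear_combination -h0)
    exact ⟨y, fun p => by simpa using (h p).2⟩
  obtain ⟨m₁, n₁, y₁, hγ₁⟩ := hcoord _ K.γ₁_mem
  obtain ⟨m₂, n₂, y₂, hγ₂⟩ := hcoord _ K.γ₂_mem
  obtain ⟨b₃, hb₃⟩ := hvert _ K.γ₃_mem fun _ => rfl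
  obtain ⟨b₄, hb₄⟩ := hvert _ K.γ₄_mem fun _ => rfl
  have e₁ : ∀ z ζ, (F (z + K.τB, ζ + K.c * z + K.δ)).1 = _ ∧
    (F (z + K.τB, ζ + K.c * z + K.δ)).2 = _ := fun z ζ => hγ₁ (z, ζ)
  have e₂ : ∀ z ζ, (F (z + 1, ζ)).1 = _ ∧ (F (z + 1, ζ)).2 = _ := fun z ζ => hγ₂ (z, ζ)
  simp only [hfst] at e₁ e₂
  have h₁ : α * K.τB = m₁ * K.τB + n₁ := by linear_combination (e₁ 0 0).1
  have h₂ : α = m₂ * K.τB + n₂ := by linear_combination (e₂ 0 0).1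
  obtain ⟨μ, A, B, C, h⟩ := exists_eq_quadratic_of_quasi_periodic (G := fun p => (F p).2)
    (a₁ := m₁ * K.c * α) (a₂ := m₂ * K.c * α)
    (b₁ := m₁ * K.c * β + (m₁ * K.δ + m₁ * (m₁ - 1) / 2 * K.c * K.τB + y₁))
    (b₂ := m₂ * K.c * β + (m₂ * K.δ + m₂ * (m₂ - 1) / 2 * K.c * K.τB + y₂)) hF.snd
    K.τB.im_pos K.τE.im_pos (fun z ζ => by rw [(e₁ z ζ).2]; ring)
    (fun z ζ => by rw [(e₂ z ζ).2]; ring)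
    (fun z ζ => hb₃ (z, ζ)) (fun z ζ => hb₄ (z, ζ))
  simp only [h] at e₁ e₂
  -- Compare the coefficients of `z` in the relations for `γ₂` and `γ₁`.
  have hA : A = m₂ * K.c * α / 2 := by linear_combination ((e₂ 1 0).2 - (e₂ 0 0).2) / 2
  have hμ : μ = (‖α‖ : ℂ) ^ 2 := by
    rw [← mul_conj_eq_norm_sq, (conj_multiplier K.τB.im_pos h₂ h₁).1]
    apply mul_right_cancel₀ K.c_ne_zero
    linear_combination (e₁ 1 0).2 - (e₁ 0 0).2 - 2 * K.τB * hA
  -- The value of `σ` is the one for which the coefficient of `z` in the special map is `B`.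
  refine ⟨α, β, B - m₂ * (K.c * β + K.ε + 1 / 2 * n₂ * K.c), C,
    ⟨m₁, n₁, m₂, n₂, h₂, h₁⟩, fun ⟨z, ζ⟩ => ?_⟩
  rw [← Prod.mk.eta (p := F (z, ζ)), hfst, h, hμ, hA]
  simp only [specialMap, D_one_of_eq h₂, D_τB_of_eq h₂]
  ext
  · rfl
  · simp only; ring

theorem exists_specialMap_lift {f : K.Surface → K.Surface}
    (hf : MDifferentiable 𝓘(ℂ, ℂ × ℂ) 𝓘(ℂ, ℂ × ℂ) f) (hsurj : Function.Surjective f) :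
    ∃ α β σ v : ℂ, α ≠ 0 ∧ (∀ x ∈ tauLattice K.τB, α * x ∈ tauLattice K.τB) ∧
      (∃ n : ℤ, ‖α‖ ^ 2 = (n : ℝ)) ∧ ∀ p, K.proj (K.specialMap α β σ v p) = f (K.proj p) := by
  obtain ⟨F, hF, hFf⟩ := K.exists_differentiable_lift hf
  obtain ⟨α, β, σ, v, ⟨m₁, n₁, m₂, n₂, h₂, h₁⟩, hS⟩ := K.exists_eq_specialMap hF
    fun g hg => K.exists_deck_comp_lift hF.continuous hFf hg
  refine ⟨α, β, σ, v, ?_, fun x hx => ?_, ⟨n₂ * m₁ - m₂ * n₁, ?_⟩, fun p => by rw [← hS, hFf]⟩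
  · -- For `α = 0` the image lies over one point of the base, and misses the point over `β + 1/2`.
    rintro rfl
    obtain ⟨x, hx⟩ := hsurj (K.proj (β + 1 / 2, 0))
    obtain ⟨p, rfl⟩ := K.proj_surjective x
    have hp : F p = (β, (F p).2) := by rw [hS]; simp [specialMap]
    rw [← hFf, hp] at hx
    obtain ⟨m, n, y, -, e, -⟩ := K.proj_eq_iff_coord.1 hx.symm
    -- Doubling clears the denominator of `1/2`, so that a parity argument applies.
    have e' : ((0 : ℤ) : ℂ) * K.τB + (1 : ℤ) = (2 * m : ℤ) * K.τB + (2 * n : ℤ) := by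
      push_cast; linear_combination 2 * e
    have := (int_coord_unique K.τB.im_pos e').2
    omega
  · obtain ⟨m, n, rfl⟩ := mem_tauLattice.1 hx
    refine mem_tauLattice.2 ⟨m * m₁ + n * m₂, m * n₁ + n * n₂, ?_⟩
    push_cast
    linear_combination m * h₁ + n * h₂
  · exact_mod_cast norm_sq_of_eq h₂ h₁

end KodairaData

theorem mainTheorem1 (K : KodairaData)
    {X : Type*} [TopologicalSpace X] [ChartedSpace (ℂ × ℂ) X] [IsManifold 𝓘(ℂ, ℂ × ℂ) ω X]
    (i : K.Surface ≃ₘ^ω⟮𝓘(ℂ, ℂ × ℂ), 𝓘(ℂ, ℂ × ℂ)⟯ X) :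
    (∀ f : X → X, MDifferentiable 𝓘(ℂ, ℂ × ℂ) 𝓘(ℂ, ℂ × ℂ) f → Function.Surjective f →
      ∃ α β σ v : ℂ, α ≠ 0 ∧ (∀ x ∈ tauLattice K.τB, α * x ∈ tauLattice K.τB) ∧
        (∃ n : ℤ, ‖α‖ ^ 2 = (n : ℝ)) ∧
        (∃ Φ : (ℂ × ℂ) ≃ₘ^ω⟮𝓘(ℂ, ℂ × ℂ), 𝓘(ℂ, ℂ × ℂ)⟯ (ℂ × ℂ),
          (∀ p, Φ p = K.specialMap α β σ v p) ∧
          ∀ p, i (K.proj (Φ p)) = f (i (K.proj p)))) ∧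
    (∀ α β σ v : ℂ, α ≠ 0 → (∀ x ∈ tauLattice K.τB, α * x ∈ tauLattice K.τB) →
      (∃ n : ℤ, ‖α‖ ^ 2 = (n : ℝ)) →
      ((∃ f : X → X, MDifferentiable 𝓘(ℂ, ℂ × ℂ) 𝓘(ℂ, ℂ × ℂ) f ∧ Function.Surjective f ∧
          ∀ p, i (K.proj (K.specialMap α β σ v p)) = f (i (K.proj p))) ↔
        (σ ∈ tauLattice K.τE ∧
          σ * K.τB - conj α * (K.c * β + (1 - α) * K.ε)
            + 1 / 2 * K.c * K.D α 1 *
              (K.D (α * K.τB) 1 * (‖(K.τB : ℂ)‖ : ℂ) ^ 2 - K.D α K.τB * K.τB)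
            ∈ tauLattice K.τE))) := by
  have hi : MDifferentiable 𝓘(ℂ, ℂ × ℂ) 𝓘(ℂ, ℂ × ℂ) i := i.mdifferentiable (by simp)
  have hi' : MDifferentiable 𝓘(ℂ, ℂ × ℂ) 𝓘(ℂ, ℂ × ℂ) i.symm := i.symm.mdifferentiable (by simp)
  refine ⟨fun f hf hs => ?_, fun α β σ v hα hΛ _ => ?_⟩
  · obtain ⟨α, β, σ, v, hα, hΛ, hn, h⟩ := K.exists_specialMap_lift (f := i.symm ∘ f ∘ i)
      (hi'.comp (hf.comp hi)) (i.symm.surjective.comp (hs.comp i.surjective))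
    refine ⟨α, β, σ, v, hα, hΛ, hn, K.specialDiffeomorph hα β σ v, fun _ => rfl, fun p => ?_⟩
    change i (K.proj (K.specialMap α β σ v p)) = _
    rw [h]
    exact i.apply_symm_apply _
  · refine Iff.trans ⟨?_, ?_⟩ (K.specialMap_descends_iff hα hΛ β σ v)
    · rintro ⟨f, hf, hs, h⟩
      refine ⟨i.symm ∘ f ∘ i, hi'.comp (hf.comp hi),
        i.symm.surjective.comp (hs.comp i.surjective), fun p => ?_⟩
      rw [Function.comp_apply, Function.comp_apply, ← h]
      exact (i.symm_apply_apply _).symm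
    · rintro ⟨f, hf, hs, h⟩
      refine ⟨i ∘ f ∘ i.symm, hi.comp (hf.comp hi'),
        i.surjective.comp (hs.comp i.symm.surjective), fun p => ?_⟩
      simp only [Function.comp_apply]
      rw [h, i.symm_apply_apply]
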